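/- Let $\lambda$ be a Young diagram with $n$ boxes, each box being identified with the pair $(i,j)$ of its column number $i$ and its row number $j$. Let $\rho^\lambda$ be the corresponding irreducible complex representation of the symmetric group $S_n$, that is, the left ideal $\mathbb{C}[S_n]\,b_\lambda a_\lambda$ with $S_n$ acting by left multiplication, where the boxes are numbered by $1,\dots,n$, $a_\lambda$ is the sum of all permutations preserving each row, and $b_\lambda$ is the sum of all permutations preserving each column, weighted by their signs. For $l\le n$ and $\pi\in S_l\subseteq S_n$ (extended by fixed points) define the normalized character $$\Sigma^\lambda(\pi)=n(n-1)\cdots(n-l+1)\,\frac{\operatorname{Tr}\rho^\lambda(\pi)}{\operatorname{Tr}\rho^\lambda(e)} .$$ Let $N$ be at least the number of rows and the number of columns of $\lambda$, and let $T_\lambda=(t_{ij})_{1\le i,j\le N}$ be a random matrix with independent entries such that, if $(i,j)\in\lambda$, then $t_{ij}$ is a complex centered Gaussian variable with $$\mathbb{E}(t_{ij})=0,\qquad \mathbb{E}(t_{ij}\overline{t_{ij}})=1,\qquad \mathbb{E}(t_{ij}^2)=0,$$ and $t_{ij}=0$ almost surely if $(i,j)\notin\lambda$. Then for every $l\le n$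 and every permutation $\pi\in S_l$ with cycle lengths $k_1,\dots,k_r$ (fixed points counted as cycles of length $1$, so that $k_1+\cdots+k_r=l$), the random variable $\prod_{i=1}^r\operatorname{Tr}\big((T_\lambda T_\lambda^\star)^{k_i}\big)$ is integrable, its expectation is real, and $$|\Sigma^\lambda(\pi)|\le \mathbb{E}\Big(\operatorname{Tr}\big((T_\lambda T_\lambda^\star)^{k_1}\big)\cdots \operatorname{Tr}\big((T_\lambda T_\lambda^\star)^{k_r}\big)\Big).$$ -/

import Mathlib

open MeasureTheory ProbabilityTheory
open scoped Matrix ComplexConjugate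

noncomputable section

namespace YoungDiagram

/-- The group algebra `ℂ[S̃_n]` of the group of permutations of the boxes of `lam`. -/
abbrev BoxAlgebra (lam : YoungDiagram) : Type := MonoidAlgebra ℂ (Equiv.Perm lam.cells)

open Classical in
/-- The permutations of the boxes which preserve each row
(in Mathlib a box is a pair (row, column)). -/
def rowGroup (lam : YoungDiagram) : Finset (Equiv.Perm lam.cells) :=
  Finset.univ.filter fun s => ∀ x : lam.cells, (s x).1.1 = x.1.1

open Classical in
/-- The permutations of the boxes which preserve each column. -/
def colGroup (lam : YoungDiagram) : Finset (Equiv.Perm lam.cells) :=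
  Finset.univ.filter fun s => ∀ x : lam.cells, (s x).1.2 = x.1.2

/-- The Young symmetrizer `c = b a`, where `a` is the sum of the row group and `b` is the signed
sum of the column group. -/
def symmetrizer (lam : YoungDiagram) : lam.BoxAlgebra :=
  (∑ s ∈ lam.colGroup, MonoidAlgebra.single s ((Equiv.Perm.sign s : ℤ) : ℂ)) *
    (∑ s ∈ lam.rowGroup, MonoidAlgebra.single s (1 : ℂ))

/-- The left ideal `V = ℂ[S̃_n] c` generated by the Young symmetrizer. -/
def irrepSpace (lam : YoungDiagram) : Submodule ℂ lam.BoxAlgebra :=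
  LinearMap.range (LinearMap.mulRight ℂ lam.symmetrizer)

theorem mulLeft_mem_irrepSpace (lam : YoungDiagram) (a : lam.BoxAlgebra) :
    ∀ v ∈ lam.irrepSpace, LinearMap.mulLeft ℂ a v ∈ lam.irrepSpace := by
  rintro _ ⟨w, rfl⟩
  exact ⟨a * w, by simp [mul_assoc]⟩

/-- The irreducible representation attached to `lam` of the group of permutations of its boxes:
left multiplication on `V`. -/
def boxIrrep (lam : YoungDiagram) :
    Representation ℂ (Equiv.Perm lam.cells) lam.irrepSpace where
  toFun s := (LinearMap.mulLeft ℂ (MonoidAlgebra.single s (1 : ℂ))).restrict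
    (lam.mulLeft_mem_irrepSpace _)
  map_one' := by
    ext v
    simp [← MonoidAlgebra.one_def]
  map_mul' s t := by
    ext v
    simp [← mul_assoc, MonoidAlgebra.single_mul_single]

/-- The irreducible representation `ρ^lam` of `S_n`, `n = |lam|`, obtained by numbering the boxes.
(Another numbering gives an isomorphic representation.) -/
def irrep (lam : YoungDiagram) :
    Representation ℂ (Equiv.Perm (Fin lam.card)) lam.irrepSpace :=
  lam.boxIrrep.comp (lam.cells.equivFin.symm.permCongrHom).toMonoidHom

/-- The character `χ^lam(π) = Tr ρ^lam(π) / Tr ρ^lam(e)`. -/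
def chi (lam : YoungDiagram) (π : Equiv.Perm (Fin lam.card)) : ℂ :=
  LinearMap.trace ℂ lam.irrepSpace (lam.irrep π) / LinearMap.trace ℂ lam.irrepSpace (lam.irrep 1)

/-- The normalized character `Σ^lam(π) = n (n-1) ⋯ (n-l+1) χ^lam(π)` of `π ∈ S_l`, `l ≤ n`,
where `π` is seen in `S_n` by letting it fix the last `n - l` points. -/
def normalizedChar (lam : YoungDiagram) {l : ℕ} (hl : l ≤ lam.card)
    (π : Equiv.Perm (Fin l)) : ℂ :=
  (lam.card.descFactorial l : ℂ) * lam.chi (π.viaEmbedding (Fin.castLEEmb hl))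

/-- `T` is the random `N × N` matrix `T_lam = (t i j)`: the entries are independent; the entry is a
complex centered Gaussian variable with `E |t i j|² = 1` and `E (t i j)² = 0` if `lam` has a box
in column `i` and row `j`, and it vanishes otherwise. -/
structure IsGaussianMatrix (lam : YoungDiagram) {Ω : Type*} [MeasurableSpace Ω] (P : Measure Ω)
    {N : ℕ} (T : Ω → Matrix (Fin N) (Fin N) ℂ) : Prop where
  indep : iIndepFun (fun (p : Fin N × Fin N) (ω : Ω) => T ω p.1 p.2) P
  gaussian : ∀ i j : Fin N, ((j : ℕ), (i : ℕ)) ∈ lam → HasGaussianLaw (fun ω => T ω i j) P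
  mean : ∀ i j : Fin N, ((j : ℕ), (i : ℕ)) ∈ lam → ∫ ω, T ω i j ∂P = 0
  variance : ∀ i j : Fin N, ((j : ℕ), (i : ℕ)) ∈ lam → ∫ ω, T ω i j * conj (T ω i j) ∂P = 1
  pseudovariance : ∀ i j : Fin N, ((j : ℕ), (i : ℕ)) ∈ lam → ∫ ω, T ω i j ^ 2 ∂P = 0
  zero : ∀ i j : Fin N, ((j : ℕ), (i : ℕ)) ∉ lam → ∀ᵐ ω ∂P, T ω i j = 0

end YoungDiagram

/-- The product of `Tr ((A A*)^k)` over the lengths `k` of all cycles of `π`, where a fixed point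
is a cycle of length one. -/
def cycleTraceProd {l N : ℕ} (π : Equiv.Perm (Fin l)) (A : Matrix (Fin N) (Fin N) ℂ) : ℂ :=
  (π.partition.parts.map fun k => ((A * Aᴴ) ^ k).trace).prod

end

/-! Both sides are compared with one count. Expanding the traces over labellings `a`, `b` of the
points of `Fin l` and applying Wick's formula to each monomial, the expectation is exactly the
number of triples `(a, b, σ)` for which every `(a m, b m)` is a box, `b` is `σ`-invariant and `a` is
invariant under `π * σ` (`integral_cycleTraceProd`); in particular it is real.

For the character, von Neumann's lemma gives `c * c = α • c` for the Young symmetrizer `c`, so the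
trace on the ideal is, up to `α`, a trace on the whole group algebra. Hence `chi` is the average
over all numberings of the boxes of a coefficient of `c` (`chi_eq`). Such a coefficient is a signed
count of row permutations `p` with `w * p` a column permutation. Dropping signs, each `p` is
supported on the boxes numbered by `Fin l` and induces a `σ` there
(`card_rowGroup_mul_mem_colGroup_le`). At most `(n - l)!` numberings extend a given placement of `l`
points, which matches the factor `n! / (n - l)!` of the normalization. -/

noncomputable section

/-! ### Products of traces along cycles as sums over labellings -/

/-- The sum over all labellings `a` of the points permuted by `σ` of the products of the entries
`M (a m) (a (σ m))`. -/
def permTrace {ι R β : Type*} [Fintype ι] [CommRing R] [Fintype β] [DecidableEq β]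
    (M : Matrix ι ι R) (σ : Equiv.Perm β) : R :=
  ∑ a : β → ι, ∏ m, M (a m) (a (σ m))

theorem permTrace_congr {ι R β γ : Type*} [Fintype ι] [CommRing R] (M : Matrix ι ι R)
    [Fintype β] [DecidableEq β] [Fintype γ] [DecidableEq γ]
    (e : β ≃ γ) {σ : Equiv.Perm β} {τ : Equiv.Perm γ} (h : ∀ x, e (σ x) = τ (e x)) :
    permTrace M σ = permTrace M τ := by
  unfold permTrace
  rw [← (e.arrowCongr (Equiv.refl ι)).sum_comp]
  refine Finset.sum_congr rfl fun a _ => ?_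
  rw [← e.prod_comp]
  refine Finset.prod_congr rfl fun m _ => ?_
  simp [← h]

theorem permTrace_isConj {ι R β : Type*} [Fintype ι] [CommRing R] (M : Matrix ι ι R)
    [Fintype β] [DecidableEq β] {σ τ : Equiv.Perm β} (h : IsConj σ τ) :
    permTrace M σ = permTrace M τ := by
  obtain ⟨c, hc⟩ := isConj_iff.1 h
  refine permTrace_congr M c fun x => ?_
  rw [← hc]
  simp

theorem permTrace_one {ι R β : Type*} [Fintype ι] [CommRing R] (M : Matrix ι ι R)
    [Fintype β] [DecidableEq β] :
    permTrace M (1 : Equiv.Perm β) = M.trace ^ Fintype.card β := by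
  have h := Finset.prod_univ_sum (fun _ : β => (Finset.univ : Finset ι)) (fun _ i => M i i)
  rw [Fintype.piFinset_univ] at h
  simpa [permTrace, Matrix.trace] using h.symm

/-- A labelling is a pair of independent labellings of the two invariant parts, and no factor links
them. -/
theorem permTrace_eq_mul {ι R β : Type*} [Fintype ι] [CommRing R] (M : Matrix ι ι R)
    [Fintype β] [DecidableEq β] (σ : Equiv.Perm β) (p : β → Prop) [DecidablePred p]
    [Fintype {x // p x}] [Fintype {x // ¬ p x}]
    (h : ∀ x, p (σ x) ↔ p x) :
    permTrace M σ = permTrace M (σ.subtypePerm h) *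
      permTrace M (σ.subtypePerm (p := fun x => ¬ p x) fun x => not_congr (h x)) := by
  rw [← permTrace_congr M (Equiv.sumCompl p) (σ := Equiv.sumCongr (σ.subtypePerm h)
    (σ.subtypePerm (p := fun x => ¬ p x) fun x => not_congr (h x)))
    (by rintro (x | x) <;> simp)]
  unfold permTrace
  rw [← (Equiv.sumArrowEquivProdArrow _ _ ι).symm.sum_comp, Fintype.sum_prod_type,
    Finset.sum_mul_sum]
  refine Finset.sum_congr rfl fun a _ => Finset.sum_congr rfl fun b _ => ?_
  rw [Fintype.prod_sum_type]
  rfl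

/-- The free closing factor `M'` drives the induction: summing over the last vertex of the path
turns `M'` into `M * M'`. -/
theorem sum_prod_path_mul {ι R : Type*} [Fintype ι] [DecidableEq ι] [CommRing R]
    (M : Matrix ι ι R) (k : ℕ) (M' : Matrix ι ι R) :
    ∑ a : Fin (k + 1) → ι, (∏ i : Fin k, M (a i.castSucc) (a i.succ)) * M' (a (Fin.last k)) (a 0) =
      (M ^ k * M').trace := by
  induction k generalizing M' with
  | zero =>
    rw [← (Equiv.funUnique (Fin 1) ι).symm.sum_comp]
    simp [Matrix.trace]
  | succ k ih =>
    rw [← (Fin.snocEquiv fun _ => ι).sum_comp, Fintype.sum_prod_type, Finset.sum_comm, pow_succ,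
      mul_assoc, ← ih]
    refine Finset.sum_congr rfl fun a _ => ?_
    rw [Matrix.mul_apply, Finset.mul_sum]
    refine Finset.sum_congr rfl fun x _ => ?_
    have h0 : (Fin.snoc a x : Fin (k + 2) → ι) 0 = a 0 := by
      rw [← Fin.castSucc_zero, Fin.snoc_castSucc (α := fun _ => ι)]
    have h1 : ∀ i : Fin k, (Fin.snoc a x : Fin (k + 2) → ι) i.castSucc.succ = a i.succ :=
      fun i => by rw [Fin.succ_castSucc, Fin.snoc_castSucc (α := fun _ => ι)]
    rw [Fin.prod_univ_castSucc]
    simp only [Fin.snocEquiv_apply, Fin.snoc_castSucc (α := fun _ => ι), h0, h1, Fin.succ_last,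
      Fin.snoc_last (α := fun _ => ι)]
    ring

theorem permTrace_finRotate {ι R : Type*} [Fintype ι] [DecidableEq ι] [CommRing R]
    (M : Matrix ι ι R) (k : ℕ) :
    permTrace M (finRotate (k + 1)) = (M ^ (k + 1)).trace := by
  rw [pow_succ, ← sum_prod_path_mul]
  refine Finset.sum_congr rfl fun a _ => ?_
  rw [Fin.prod_univ_castSucc]
  simp

/-- On its support a cycle moves every point, so it is conjugate to `finRotate`. -/
theorem permTrace_subtypePerm_support_of_isCycle {ι R β : Type*} [Fintype ι] [DecidableEq ι]
    [CommRing R] (M : Matrix ι ι R) [Fintype β] [DecidableEq β] {σ : Equiv.Perm β}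
    (hσ : σ.IsCycle) :
    permTrace M (σ.subtypePerm (p := (· ∈ σ.support)) fun _ => Equiv.Perm.apply_mem_support) =
      (M ^ σ.support.card).trace := by
  obtain ⟨k, hk⟩ : ∃ k, σ.support.card = k + 2 :=
    ⟨σ.support.card - 2, by have := hσ.two_le_card_support; omega⟩
  have hc : Fintype.card {x // x ∈ σ.support} = k + 2 := by
    rw [Fintype.card_coe, hk]
  let e := Fintype.equivFinOfCardEq hc
  let τ := σ.subtypePerm (p := (· ∈ σ.support)) fun _ => Equiv.Perm.apply_mem_support
  have hmove : ∀ x, τ x ≠ x := fun x hx =>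
    Equiv.Perm.mem_support.1 x.2 (congrArg Subtype.val hx)
  have hτ : τ.IsCycle := by
    obtain ⟨x, hx, h⟩ := hσ
    refine ⟨⟨x, Equiv.Perm.mem_support.2 hx⟩, hmove _, fun y _ => ?_⟩
    obtain ⟨i, hi⟩ := h (Equiv.Perm.mem_support.1 y.2)
    exact ⟨i, Subtype.ext (by simpa [τ] using hi)⟩
  rw [permTrace_congr M e (τ := e.permCongr τ) (by simp [τ]), hk, ← permTrace_finRotate M (k + 1)]
  refine permTrace_isConj M ?_
  have h1 : (e.permCongr τ).IsCycle := by
    obtain ⟨x, hx, h⟩ := hτ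
    refine ⟨e x, by simpa using hx, fun y _ => ?_⟩
    obtain ⟨i, hi⟩ := h (hmove (e.symm y))
    refine ⟨i, ?_⟩
    change (e.permCongrHom τ ^ i) (e x) = y
    rw [← map_zpow]
    simp [hi]
  rw [h1.isConj_iff (isCycle_finRotate (n := k)), support_finRotate]
  congr 1
  ext x
  have hx := hmove (e.symm x)
  rw [Ne, ← e.apply_eq_iff_eq, Equiv.apply_symm_apply] at hx
  simpa using hx

theorem permTrace_eq_prod_partition {ι R β : Type*} [Fintype ι] [DecidableEq ι]
    [CommRing R] (M : Matrix ι ι R) [Fintype β] [DecidableEq β] (σ : Equiv.Perm β) :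
    permTrace M σ = (σ.partition.parts.map fun k => (M ^ k).trace).prod := by
  -- The induction is run on supports only, where disjoint factors multiply; on all of `β` the fixed
  -- points of each factor would be counted too. Fixed points are restored at the end.
  have key : permTrace M
      (σ.subtypePerm (p := (· ∈ σ.support)) fun _ => Equiv.Perm.apply_mem_support) =
      (σ.cycleType.map fun k => (M ^ k).trace).prod := by
    induction σ using Equiv.Perm.cycle_induction_on with
    | base_one =>
      have : IsEmpty {x // x ∈ (1 : Equiv.Perm β).support} := ⟨fun x => by simpa using x.2⟩
      simp [permTrace]
    | base_cycles σ hσ => simp [permTrace_subtypePerm_support_of_isCycle M hσ, hσ.cycleType]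
    | induction_disjoint σ τ hd hσ h1 h2 =>
      rw [hd.cycleType_mul, Multiset.map_add, Multiset.prod_add, ← h1, ← h2]
      have hs := hd.support_mul
      have hdis := Finset.disjoint_left.1 hd.disjoint_support
      have hfix : ∀ x ∈ σ.support, (σ * τ) x = σ x := fun x hx => by
        rw [Equiv.Perm.mul_apply, Equiv.Perm.notMem_support.1 (hdis hx)]
      have hfix' : ∀ x ∉ σ.support, (σ * τ) x = τ x := fun x hx => by
        rw [hd.commute.eq, Equiv.Perm.mul_apply, Equiv.Perm.notMem_support.1 hx]
      have hinv : ∀ x, (σ * τ) x ∈ σ.support ↔ x ∈ σ.support := fun x => by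
        by_cases hx : x ∈ σ.support
        · rw [hfix x hx, Equiv.Perm.apply_mem_support]
        · refine iff_of_false ?_ hx
          rw [hfix' x hx]
          by_cases hx' : x ∈ τ.support
          · exact fun h => hdis h (Equiv.Perm.apply_mem_support.2 hx')
          · rwa [Equiv.Perm.notMem_support.1 hx']
      rw [permTrace_eq_mul M _ (fun x => x.1 ∈ σ.support) (fun x => by simpa using hinv x.1)]
      congr 1
      · refine permTrace_congr M ⟨fun x => ⟨x.1.1, x.2⟩,
          fun x => ⟨⟨x.1, hs ▸ Finset.mem_union_left _ x.2⟩, x.2⟩, fun _ => rfl, fun _ => rfl⟩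
          fun x => Subtype.ext (by simpa using hfix x.1.1 x.2)
      · refine permTrace_congr M
          ⟨fun x => ⟨x.1.1, (Finset.mem_union.1 (hs ▸ x.1.2)).resolve_left x.2⟩,
          fun x => ⟨⟨x.1, hs ▸ Finset.mem_union_right _ x.2⟩, fun h => hdis h x.2⟩,
          fun _ => rfl, fun _ => rfl⟩
          fun x => Subtype.ext (by simpa using hfix' x.1.1 x.2)
  rw [permTrace_eq_mul M σ (· ∈ σ.support) fun _ => Equiv.Perm.apply_mem_support,
    Equiv.Perm.parts_partition, Multiset.map_add, Multiset.prod_add, ← key]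
  congr 1
  have h1 : σ.subtypePerm (p := fun x => ¬ x ∈ σ.support)
      (fun x => not_congr Equiv.Perm.apply_mem_support) = 1 := by
    ext x
    simpa using x.2
  rw [h1, permTrace_one, Multiset.map_replicate, Multiset.prod_replicate, pow_one]
  congr 1
  rw [Fintype.card_subtype_compl]
  congr 1
  exact Fintype.card_of_subtype _ fun _ => Iff.rfl

/-! ### The standard complex Gaussian law and its moments -/

/-- The standard complex Gaussian measure, with density `π⁻¹ exp (-|z|²)`. -/
def stdComplexGaussian : Measure ℂ :=
  (volume : Measure ℂ).withDensity fun z => ENNReal.ofReal (Real.pi⁻¹ * Real.exp (-‖z‖ ^ 2))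

theorem integral_stdComplexGaussian (f : ℂ → ℂ) :
    ∫ z, f z ∂stdComplexGaussian = ∫ z : ℂ, ((Real.pi⁻¹ * Real.exp (-‖z‖ ^ 2) : ℝ) : ℂ) * f z := by
  unfold stdComplexGaussian
  rw [integral_withDensity_eq_integral_toReal_smul₀ (by fun_prop)
    (Filter.Eventually.of_forall fun _ => ENNReal.ofReal_lt_top)]
  refine integral_congr_ae (Filter.Eventually.of_forall fun z => ?_)
  have : 0 ≤ Real.pi⁻¹ * Real.exp (-‖z‖ ^ 2) := by positivity
  simp only [ENNReal.toReal_ofReal this, Complex.real_smul]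

instance : IsFiniteMeasure stdComplexGaussian := by
  refine isFiniteMeasure_withDensity_ofReal (Integrable.hasFiniteIntegral ?_)
  have h := (GaussianFourier.integrable_cexp_neg_mul_sq_norm_add (V := ℂ) (b := 1) (by simp) 0 0).re
  refine (h.congr (Filter.Eventually.of_forall fun z => ?_)).const_mul _
  change (Complex.exp _).re = _
  rw [← Complex.ofReal_re (Real.exp (-‖z‖ ^ 2))]
  push_cast
  simp

theorem charFun_stdComplexGaussian (t : ℂ) :
    charFun stdComplexGaussian t = Complex.exp (-(‖t‖ : ℂ) ^ 2 / 4) := by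
  rw [charFun_apply, integral_stdComplexGaussian]
  have h := GaussianFourier.integral_cexp_neg_mul_sq_norm_add (V := ℂ) (b := 1) (by simp)
    Complex.I t
  have hpi : (Real.pi : ℂ) ≠ 0 := by exact_mod_cast Real.pi_ne_zero
  calc _ = ∫ v : ℂ, (Real.pi : ℂ)⁻¹ *
        Complex.exp (-1 * (‖v‖ : ℂ) ^ 2 + Complex.I * (inner ℝ t v : ℝ)) := by
        refine integral_congr_ae (Filter.Eventually.of_forall fun z => ?_)
        simp only []
        rw [Complex.exp_add, real_inner_comm z t]
        push_cast
        ring_nf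
    _ = _ := by
        rw [integral_const_mul, h, Complex.finrank_real_complex]
        simp [hpi]

/-- A Gaussian law on the real plane is determined by the means and variances of its projections
`inner ℝ t X`, and the squares of these are real parts of combinations of `X ^ 2` and `X * conj X`.
-/
theorem ProbabilityTheory.HasGaussianLaw.map_eq_stdComplexGaussian
    {Ω : Type*} [MeasurableSpace Ω] {P : Measure Ω} {X : Ω → ℂ} (hX : HasGaussianLaw X P)
    (h0 : ∫ ω, X ω ∂P = 0) (h1 : ∫ ω, X ω * conj (X ω) ∂P = 1) (h2 : ∫ ω, X ω ^ 2 ∂P = 0) :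
    P.map X = stdComplexGaussian := by
  have hP := hX.isProbabilityMeasure
  have hm := hX.isGaussian_map
  have hmem := hX.memLp_two
  refine Measure.ext_of_charFun (funext fun t => ?_)
  rw [charFun_stdComplexGaussian, hX.charFun_map_eq]
  have hI2 : Integrable (fun ω => X ω ^ 2) P := by
    simpa [sq] using! hmem.integrable_mul hmem
  have hI1 : Integrable (fun ω => X ω * conj (X ω)) P := by
    exact hmem.integrable_mul hmem.star
  have hmean : ∫ ω, inner ℝ t (X ω) ∂P = 0 := by
    rw [integral_inner hX.integrable, h0, inner_zero_right]
  have hvar : Var[fun ω ↦ inner ℝ t (X ω); P] = ‖t‖ ^ 2 / 2 := by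
    rw [variance_of_integral_eq_zero (by exact (aemeasurable_const.inner hX.aemeasurable)) hmean]
    have h : ∀ ω, inner ℝ t (X ω) ^ 2 =
        ((conj t ^ 2 * X ω ^ 2 + (‖t‖ ^ 2 : ℝ) * (X ω * conj (X ω))) / 2 : ℂ).re := by
      intro ω
      rw [← Complex.normSq_eq_norm_sq, Complex.normSq_apply]
      simp [Complex.inner, sq]
      ring
    simp_rw [h]
    have hint : Integrable (fun ω =>
      (conj t ^ 2 * X ω ^ 2 + (‖t‖ ^ 2 : ℝ) * (X ω * conj (X ω))) / 2) P :=
      ((hI2.const_mul _).add (hI1.const_mul _)).div_const _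
    have := integral_re hint
    simp only [RCLike.re_to_complex] at this
    rw [this, integral_div, integral_add (hI2.const_mul _) (hI1.const_mul _), integral_const_mul,
      integral_const_mul, h1, h2]
    rw [mul_zero, zero_add, mul_one, ← Complex.ofReal_ofNat, ← Complex.ofReal_div,
      Complex.ofReal_re]
  rw [hmean, hvar]
  congr 1
  push_cast
  ring

theorem integral_pow_mul_conj_pow_stdComplexGaussian (a b : ℕ) :
    ∫ z, z ^ a * conj z ^ b ∂stdComplexGaussian = if a = b then (a.factorial : ℂ) else 0 := by
  rw [integral_stdComplexGaussian]
  split_ifs with hab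
  · subst hab
    have h := Complex.integral_rpow_mul_exp_neg_rpow (p := 2) (q := 2 * a) (by norm_num)
      (by have : (0 : ℝ) ≤ a := by positivity
          linarith)
    have h2 : ((2 : ℝ) * a + 2) / 2 = a + 1 := by ring
    rw [h2, Real.Gamma_nat_eq_factorial] at h
    calc _ = ∫ z : ℂ,
          ((Real.pi⁻¹ * (‖z‖ ^ (2 * (a : ℝ)) * Real.exp (-‖z‖ ^ (2 : ℝ))) : ℝ) : ℂ) := by
          refine integral_congr_ae (Filter.Eventually.of_forall fun z => ?_)
          simp only []
          rw [← mul_pow, Complex.mul_conj, Complex.normSq_eq_norm_sq, Real.rpow_mul (norm_nonneg _),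
            Real.rpow_natCast, Real.rpow_two]
          push_cast
          ring
      _ = _ := by
          rw [integral_complex_ofReal, integral_const_mul, h]
          have := Real.pi_ne_zero
          push_cast
          field_simp
  -- The density is rotation invariant, and rotation by `θ` multiplies the integrand by `exp (i (a -
  -- b) θ) = -1`.
  · set θ : ℝ := Real.pi / ((a : ℝ) - b) with hθ
    have hne : (a : ℝ) - b ≠ 0 := sub_ne_zero.2 (by exact_mod_cast hab)
    have hu : ((Circle.exp θ : Circle) : ℂ) ^ a * conj ((Circle.exp θ : Circle) : ℂ) ^ b = -1 := by
      rw [Circle.coe_exp, ← Complex.exp_conj, ← Complex.exp_nat_mul, ← Complex.exp_nat_mul,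
        ← Complex.exp_add, ← Complex.exp_pi_mul_I]
      congr 1
      simp only [map_mul, Complex.conj_ofReal, Complex.conj_I]
      have : (Real.pi : ℂ) = θ * (a - b) := by
        rw [hθ]
        push_cast
        rw [div_mul_cancel₀]
        exact_mod_cast hne
      rw [this]
      ring
    have h := (rotation (Circle.exp θ)).measurePreserving.integral_comp
      (rotation (Circle.exp θ)).toHomeomorph.measurableEmbedding
      (fun z : ℂ => ((Real.pi⁻¹ * Real.exp (-‖z‖ ^ 2) : ℝ) : ℂ) * (z ^ a * conj z ^ b))
    have h' : ∀ z : ℂ, ((Real.pi⁻¹ * Real.exp (-‖rotation (Circle.exp θ) z‖ ^ 2) : ℝ) : ℂ) *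
        (rotation (Circle.exp θ) z ^ a * conj (rotation (Circle.exp θ) z) ^ b) =
        -(((Real.pi⁻¹ * Real.exp (-‖z‖ ^ 2) : ℝ) : ℂ) * (z ^ a * conj z ^ b)) := by
      intro z
      rw [LinearIsometryEquiv.norm_map, rotation_apply, map_mul, mul_pow, mul_pow,
        mul_mul_mul_comm, hu]
      ring
    simp_rw [h'] at h
    rw [integral_neg] at h
    exact self_eq_neg.1 h.symm

/-! ### Wick's formula -/

-- Such a `σ` carries each fibre of `x` onto the fibre of `y` over the same point. If the fibre
-- sizes agree, the solutions form a coset of the stabilizer of `x`.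
open Classical in
theorem card_perm_comp_eq {α κ : Type*} [Fintype α] [DecidableEq α] [Fintype κ] (x y : α → κ) :
    Fintype.card {σ : Equiv.Perm α // y ∘ σ = x} =
      ∏ p, if Fintype.card {m // x m = p} = Fintype.card {m // y m = p}
        then (Fintype.card {m // x m = p}).factorial else 0 := by
  by_cases h : ∀ p, Fintype.card {m // x m = p} = Fintype.card {m // y m = p}
  · have e : ∀ p, Nonempty ({m // x m = p} ≃ {m // y m = p}) := fun p => Fintype.card_eq.1 (h p)
    let s : Equiv.Perm α := Equiv.ofFiberEquiv fun p => (e p).some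
    have hs : y ∘ s = x := funext fun a => Equiv.ofFiberEquiv_map _ a
    simp only [h, if_true]
    simp only [← h]
    refine Eq.trans ?_ ((DomMulAct.stabilizer_card x).trans (Finset.prod_congr rfl fun p _ => ?_))
    swap; · congr!
    refine Fintype.card_congr ((Equiv.mulLeft s⁻¹).subtypeEquiv fun σ => ?_)
    rw [← hs]
    simp [Function.comp_assoc, ← Equiv.Perm.coe_mul]
  · rw [not_forall] at h
    obtain ⟨p, hp⟩ := h
    rw [Finset.prod_eq_zero (Finset.mem_univ p) (if_neg hp), Fintype.card_eq_zero_iff]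
    refine ⟨fun σ => hp (Fintype.card_congr (σ.1.subtypeEquiv fun m => ?_))⟩
    rw [← congrFun σ.2 m, Function.comp_apply]

open Classical in
theorem prod_comp_eq_prod_pow_card {α κ R : Type*} [Fintype α] [Fintype κ] [CommMonoid R]
    (x : α → κ) (f : κ → R) : ∏ m, f (x m) = ∏ p, f p ^ Fintype.card {m // x m = p} := by
  rw [← Finset.prod_fiberwise Finset.univ x]
  refine Finset.prod_congr rfl fun p _ => ?_
  rw [Finset.prod_congr rfl (g := fun _ => f p) (fun m hm => by rw [(Finset.mem_filter.1 hm).2]),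
    Finset.prod_const, Fintype.card_subtype]

open Classical in
/-- Wick's formula for independent complex variables, each of which is either standard Gaussian
(for indices in `S`) or zero. -/
theorem integral_prod_mul_conj_of_iIndepFun {Ω α κ : Type*} [MeasurableSpace Ω] {P : Measure Ω}
    [Fintype α] [Fintype κ] {z : κ → Ω → ℂ} (hz : iIndepFun z P)
    (hm : ∀ p, AEMeasurable (z p) P) (S : Set κ)
    (hS : ∀ p ∈ S, P.map (z p) = stdComplexGaussian) (hS' : ∀ p ∉ S, ∀ᵐ ω ∂P, z p ω = 0)
    (x y : α → κ) :
    ∫ ω, ∏ m, (z (x m) ω * conj (z (y m) ω)) ∂P =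
      if ∀ m, x m ∈ S then (Fintype.card {σ : Equiv.Perm α // y ∘ σ = x} : ℂ) else 0 := by
  have hP := hz.isProbabilityMeasure
  split_ifs with hx
  swap
  · rw [not_forall] at hx
    obtain ⟨m, hm⟩ := hx
    refine integral_eq_zero_of_ae ?_
    filter_upwards [hS' _ hm] with ω hω
    exact Finset.prod_eq_zero (Finset.mem_univ m) (by rw [hω, zero_mul])
  have h1 : ∀ ω, ∏ m, (z (x m) ω * conj (z (y m) ω)) =
      ∏ p, (fun w : ℂ => w ^ Fintype.card {m // x m = p} * conj w ^ Fintype.card {m // y m = p})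
        (z p ω) := fun ω => by
    rw [Finset.prod_mul_distrib, prod_comp_eq_prod_pow_card x fun p => z p ω,
      prod_comp_eq_prod_pow_card y fun p => conj (z p ω), Finset.prod_mul_distrib]
  simp_rw [h1]
  rw [hz.integral_fun_prod_comp hm (f := fun p w => w ^ Fintype.card {m // x m = p} *
      conj w ^ Fintype.card {m // y m = p})
      (fun p => Continuous.aestronglyMeasurable (by fun_prop)),
    card_perm_comp_eq, Nat.cast_prod]
  refine Finset.prod_congr rfl fun p _ => ?_
  rw [Nat.cast_ite, Nat.cast_zero]
  by_cases hp : p ∈ S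
  · rw [← integral_pow_mul_conj_pow_stdComplexGaussian, ← hS p hp,
      integral_map (hm p) (Continuous.aestronglyMeasurable (by fun_prop))]
  -- Here `z p` vanishes and never occurs unconjugated, so both sides reduce to `0 ^ k`, which is
  -- `1` exactly when `k = 0`.
  · have hxe : Fintype.card {m // x m = p} = 0 :=
      Fintype.card_eq_zero_iff.2 ⟨fun m => hp (m.2 ▸ hx m.1)⟩
    rw [hxe]
    have : ∀ᵐ ω ∂P, (z p ω) ^ 0 * conj (z p ω) ^ Fintype.card {m // y m = p} =
        if 0 = Fintype.card {m // y m = p} then 1 else 0 := by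
      filter_upwards [hS' p hp] with ω hω
      rw [hω, map_zero, zero_pow_eq, zero_pow_eq]
      simp [eq_comm]
    rw [integral_congr_ae this]
    simp

theorem YoungDiagram.IsGaussianMatrix.memLp {lam : YoungDiagram} {Ω : Type*} [MeasurableSpace Ω]
    {P : Measure Ω} [IsProbabilityMeasure P] {N : ℕ} {T : Ω → Matrix (Fin N) (Fin N) ℂ}
    (hT : lam.IsGaussianMatrix P T) (i j : Fin N) {q : ENNReal} (hq : q ≠ ⊤) :
    MemLp (fun ω => T ω i j) q P := by
  by_cases h : ((j : ℕ), (i : ℕ)) ∈ lam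
  · exact (hT.gaussian i j h).memLp hq
  · exact (memLp_congr_ae (hT.zero i j h)).2 MemLp.zero

theorem memLp_two_prod {Ω α : Type*} [MeasurableSpace Ω] {P : Measure Ω}
    [IsProbabilityMeasure P] [Fintype α] {f : α → Ω → ℂ}
    (hf : ∀ m (q : ENNReal), q ≠ ⊤ → MemLp (f m) q P) :
    MemLp (fun ω => ∏ m, f m ω) 2 P := by
  -- Hölder with `card α` factors in `L^(2 * card α)`; an inequality of exponents covers empty `α`
  -- as well.
  refine MemLp.mono_exponent (MemLp.prod' (s := Finset.univ) (p := fun _ => 2 * Fintype.card α)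
    fun m _ => hf m _ (by finiteness)) ?_
  rw [ENNReal.le_inv_iff_le_inv, Finset.sum_const, nsmul_eq_mul, Finset.card_univ,
    ENNReal.mul_inv (by simp) (by simp), mul_left_comm]
  exact mul_le_of_le_one_right' (ENNReal.mul_inv_le_one _)

theorem integrable_prod_mul_conj {Ω α κ : Type*} [MeasurableSpace Ω] {P : Measure Ω}
    [IsProbabilityMeasure P] [Fintype α] {z : κ → Ω → ℂ}
    (hz : ∀ p (q : ENNReal), q ≠ ⊤ → MemLp (z p) q P) (x y : α → κ) :
    Integrable (fun ω => ∏ m, (z (x m) ω * conj (z (y m) ω))) P := by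
  simp_rw [Finset.prod_mul_distrib]
  exact (memLp_two_prod fun m => hz (x m)).integrable_mul
    (memLp_two_prod fun m q hq => (hz (y m) q hq).star)

/-! ### The expectation as a number of labellings -/

theorem cycleTraceProd_eq_sum {l N : ℕ} (π : Equiv.Perm (Fin l)) (A : Matrix (Fin N) (Fin N) ℂ) :
    cycleTraceProd π A = ∑ a : Fin l → Fin N, ∑ b : Fin l → Fin N,
      ∏ m, (A (a m) (b m) * conj (A (a (π m)) (b m))) := by
  unfold cycleTraceProd
  rw [← permTrace_eq_prod_partition]
  refine Finset.sum_congr rfl fun a _ => ?_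
  simp_rw [Matrix.mul_apply]
  rw [Finset.prod_univ_sum, Fintype.piFinset_univ]
  rfl

open Classical in
/-- The number of labellings of `Fin l` by boxes of `lam` (with column `a` and row `b`) together
with a permutation `σ` such that the row is invariant under `σ` and the column is invariant under
`π * σ`. -/
def YoungDiagram.countLabellings (lam : YoungDiagram) {l : ℕ} (N : ℕ) (π : Equiv.Perm (Fin l)) :
    ℕ :=
  Fintype.card {t : (Fin l → Fin N) × (Fin l → Fin N) × Equiv.Perm (Fin l) //
    (∀ m, ((t.2.1 m : ℕ), (t.1 m : ℕ)) ∈ lam) ∧ t.1 ∘ (π * t.2.2) = t.1 ∧ t.2.1 ∘ t.2.2 = t.2.1}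

theorem YoungDiagram.IsGaussianMatrix.integrable_cycleTraceProd {lam : YoungDiagram} {Ω : Type*}
    [MeasurableSpace Ω] {P : Measure Ω} [IsProbabilityMeasure P] {N l : ℕ}
    {T : Ω → Matrix (Fin N) (Fin N) ℂ} (hT : lam.IsGaussianMatrix P T) (π : Equiv.Perm (Fin l)) :
    Integrable (fun ω => cycleTraceProd π (T ω)) P := by
  simp_rw [cycleTraceProd_eq_sum]
  refine integrable_finsetSum _ fun a _ => integrable_finsetSum _ fun b _ => ?_
  exact integrable_prod_mul_conj (z := fun (p : Fin N × Fin N) ω => T ω p.1 p.2)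
    (fun p q hq => hT.memLp p.1 p.2 hq) (fun m => (a m, b m)) (fun m => (a (π m), b m))

theorem YoungDiagram.IsGaussianMatrix.integral_cycleTraceProd {lam : YoungDiagram} {Ω : Type*}
    [MeasurableSpace Ω] {P : Measure Ω} [IsProbabilityMeasure P] {N l : ℕ}
    {T : Ω → Matrix (Fin N) (Fin N) ℂ} (hT : lam.IsGaussianMatrix P T) (π : Equiv.Perm (Fin l)) :
    ∫ ω, cycleTraceProd π (T ω) ∂P = (lam.countLabellings N π : ℂ) := by
  classical
  have hint := fun a b : Fin l → Fin N =>
    integrable_prod_mul_conj (z := fun (p : Fin N × Fin N) ω => T ω p.1 p.2)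
      (fun p q hq => hT.memLp p.1 p.2 hq) (fun m => (a m, b m)) (fun m => (a (π m), b m))
  have hwick := fun a b : Fin l → Fin N =>
    integral_prod_mul_conj_of_iIndepFun hT.indep
      (fun p => (hT.memLp p.1 p.2 (q := 1) (by simp)).aestronglyMeasurable.aemeasurable)
      {p | ((p.2 : ℕ), (p.1 : ℕ)) ∈ lam}
      (fun p hp => (hT.gaussian p.1 p.2 hp).map_eq_stdComplexGaussian (hT.mean _ _ hp)
        (hT.variance _ _ hp) (hT.pseudovariance _ _ hp))
      (fun p hp => hT.zero p.1 p.2 hp) (fun m => (a m, b m)) (fun m => (a (π m), b m))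
  simp_rw [cycleTraceProd_eq_sum]
  rw [integral_finsetSum _ fun a _ => integrable_finsetSum _ fun b _ => hint a b]
  simp_rw [fun a => integral_finsetSum Finset.univ fun b _ => hint a b, hwick]
  rw [YoungDiagram.countLabellings, Fintype.card_subtype, Finset.card_filter, Fintype.sum_prod_type]
  simp_rw [Fintype.sum_prod_type]
  rw [Nat.cast_sum]
  refine Finset.sum_congr rfl fun a _ => ?_
  rw [Nat.cast_sum]
  refine Finset.sum_congr rfl fun b _ => ?_
  rw [Fintype.card_subtype, Finset.card_filter]
  split_ifs with h
  · rw [Nat.cast_inj]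
    refine Finset.sum_congr rfl fun s _ => ?_
    refine if_congr ?_ rfl rfl
    simp only [funext_iff, Function.comp_apply, Prod.mk.injEq, Equiv.Perm.mul_apply]
    exact ⟨fun H => ⟨h, fun m => (H m).1, fun m => (H m).2⟩, fun H m => ⟨H.2.1 m, H.2.2 m⟩⟩
  · symm
    rw [Nat.cast_eq_zero]
    exact Finset.sum_eq_zero fun s _ => if_neg fun H => h H.1

/-! ### Row and column groups, and the Young symmetrizer -/

namespace YoungDiagram

variable {lam : YoungDiagram}

theorem mem_rowGroup {s : Equiv.Perm lam.cells} :
    s ∈ lam.rowGroup ↔ ∀ x : lam.cells, (s x).1.1 = x.1.1 := by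
  simp [rowGroup]

theorem mem_colGroup {s : Equiv.Perm lam.cells} :
    s ∈ lam.colGroup ↔ ∀ x : lam.cells, (s x).1.2 = x.1.2 := by
  simp [colGroup]

theorem mul_mem_rowGroup {s t : Equiv.Perm lam.cells} (hs : s ∈ lam.rowGroup)
    (ht : t ∈ lam.rowGroup) : s * t ∈ lam.rowGroup :=
  mem_rowGroup.2 fun x => (mem_rowGroup.1 hs (t x)).trans (mem_rowGroup.1 ht x)

theorem mul_mem_colGroup {s t : Equiv.Perm lam.cells} (hs : s ∈ lam.colGroup)
    (ht : t ∈ lam.colGroup) : s * t ∈ lam.colGroup :=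
  mem_colGroup.2 fun x => (mem_colGroup.1 hs (t x)).trans (mem_colGroup.1 ht x)

theorem inv_mem_rowGroup {s : Equiv.Perm lam.cells} (hs : s ∈ lam.rowGroup) :
    s⁻¹ ∈ lam.rowGroup :=
  mem_rowGroup.2 fun x => by simpa using (mem_rowGroup.1 hs (s⁻¹ x)).symm

theorem inv_mem_colGroup {s : Equiv.Perm lam.cells} (hs : s ∈ lam.colGroup) :
    s⁻¹ ∈ lam.colGroup :=
  mem_colGroup.2 fun x => by simpa using (mem_colGroup.1 hs (s⁻¹ x)).symm

theorem eq_one_of_mem_rowGroup_of_mem_colGroup {s : Equiv.Perm lam.cells} (hs : s ∈ lam.rowGroup)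
    (hs' : s ∈ lam.colGroup) : s = 1 :=
  Equiv.ext fun x => Subtype.ext (Prod.ext (mem_rowGroup.1 hs x) (mem_colGroup.1 hs' x))

theorem swap_mem_rowGroup {x y : lam.cells} (h : x.1.1 = y.1.1) :
    Equiv.swap x y ∈ lam.rowGroup :=
  mem_rowGroup.2 fun z => by
    by_cases hx : z = x
    · rw [hx, Equiv.swap_apply_left, h]
    by_cases hy : z = y
    · rw [hy, Equiv.swap_apply_right, h]
    · rw [Equiv.swap_apply_of_ne_of_ne hx hy]

theorem swap_mem_colGroup {x y : lam.cells} (h : x.1.2 = y.1.2) :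
    Equiv.swap x y ∈ lam.colGroup :=
  mem_colGroup.2 fun z => by
    by_cases hx : z = x
    · rw [hx, Equiv.swap_apply_left, h]
    by_cases hy : z = y
    · rw [hy, Equiv.swap_apply_right, h]
    · rw [Equiv.swap_apply_of_ne_of_ne hx hy]

/-- If a permutation never sends two boxes of one row into one column, then the box at the
crossing of the row of `x` and the column of `g x` exists. -/
theorem mem_of_injective_columns (g : Equiv.Perm lam.cells)
    (hg : ∀ x y : lam.cells, x.1.1 = y.1.1 → (g x).1.2 = (g y).1.2 → x = y) (x : lam.cells) :
    (x.1.1, (g x).1.2) ∈ lam := by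
  classical
  by_contra hx
  rw [mem_iff_lt_rowLen, not_lt] at hx
  set k := lam.rowLen x.1.1 with hk
  -- Suppose `g x` lies in a column `≥ k`, with `k` the length of the row of `x`. As `g` is
  -- bijective, as many boxes are sent into the first `k` columns as lie there. But row by row no
  -- more can be sent there: a row of length `≤ k` lies there entirely, and a longer one sends at
  -- most one box into each column. In the row of `x` the inequality is strict.
  let A : Finset lam.cells := Finset.univ.filter fun y => (g y).1.2 < k
  let B : Finset lam.cells := Finset.univ.filter fun y => y.1.2 < k
  have hAB : A.card = B.card := by
    refine Finset.card_bij (fun y _ => g y) (fun y hy => by simpa [A, B] using hy)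
      (fun _ _ _ _ h => g.injective h) fun y hy => ⟨g.symm y, by simpa [A, B] using hy, by simp⟩
  have hrow : ∀ r, (A.filter fun y => y.1.1 = r).card ≤ (B.filter fun y => y.1.1 = r).card := by
    intro r
    rcases le_or_gt (lam.rowLen r) k with hr | hr
    · refine Finset.card_le_card fun y hy => ?_
      have hyr := (Finset.mem_filter.1 hy).2
      refine Finset.mem_filter.2 ⟨Finset.mem_filter.2 ⟨Finset.mem_univ _, ?_⟩, hyr⟩
      exact (lam.mem_iff_lt_rowLen.1 (hyr ▸ (lam.mem_cells _).1 y.2 : (r, y.1.2) ∈ lam)).trans_le hr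
    · have h1 : (A.filter fun y => y.1.1 = r).card ≤ k := by
        rw [← Finset.card_range k]
        refine Finset.card_le_card_of_injOn (fun y => (g y).1.2) (fun y hy => ?_)
          fun y hy z hz h => hg y z ?_ h
        · simpa using (Finset.mem_filter.1 (Finset.mem_filter.1 hy).1).2
        · rw [(Finset.mem_filter.1 hy).2, (Finset.mem_filter.1 hz).2]
      refine h1.trans ?_
      conv_lhs => rw [← Finset.card_range k]
      refine Finset.card_le_card_of_surjOn (fun y => y.1.2) fun c hc => ?_
      have hc' : c < k := by simpa using hc
      exact ⟨⟨(r, c), (lam.mem_cells _).2 (lam.mem_iff_lt_rowLen.2 (hc'.trans hr))⟩,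
        by simpa [B] using hc', rfl⟩
  have hlt : (A.filter fun y => y.1.1 = x.1.1).card < (B.filter fun y => y.1.1 = x.1.1).card := by
    refine Finset.card_lt_card (Finset.ssubset_iff_of_subset (fun y hy => ?_) |>.2 ⟨x, ?_, ?_⟩)
    · have hyr := (Finset.mem_filter.1 hy).2
      refine Finset.mem_filter.2 ⟨Finset.mem_filter.2 ⟨Finset.mem_univ _, ?_⟩, hyr⟩
      exact lam.mem_iff_lt_rowLen.1 (hyr ▸ (lam.mem_cells _).1 y.2 : (x.1.1, y.1.2) ∈ lam)
    · refine Finset.mem_filter.2 ⟨Finset.mem_filter.2 ⟨Finset.mem_univ _, ?_⟩, rfl⟩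
      exact lam.mem_iff_lt_rowLen.1 ((lam.mem_cells _).1 x.2 : (x.1.1, x.1.2) ∈ lam)
    · intro h
      exact absurd (Finset.mem_filter.1 (Finset.mem_filter.1 h).1).2 (not_lt.2 hx)
  have hmem : ∀ y ∈ (Finset.univ : Finset lam.cells), y.1.1 ∈ Finset.univ.image
      fun y : lam.cells => y.1.1 := fun y hy => Finset.mem_image_of_mem _ hy
  have key : A.card < B.card := by
    rw [Finset.card_eq_sum_card_fiberwise (s := A) fun y _ => hmem y (Finset.mem_univ _),
      Finset.card_eq_sum_card_fiberwise (s := B) fun y _ => hmem y (Finset.mem_univ _)]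
    exact Finset.sum_lt_sum (fun r _ => hrow r) ⟨x.1.1, hmem x (Finset.mem_univ _), hlt⟩
  exact key.ne hAB

/-- The inverse of `p` moves each `x` along its row to the column of `g x`; what remains of `g` then
preserves columns. -/
theorem exists_rowGroup_mul_mem_colGroup (g : Equiv.Perm lam.cells)
    (hg : ∀ x y : lam.cells, x.1.1 = y.1.1 → (g x).1.2 = (g y).1.2 → x = y) :
    ∃ p ∈ lam.rowGroup, g * p ∈ lam.colGroup := by
  let f : lam.cells → lam.cells := fun x =>
    ⟨_, (lam.mem_cells _).2 (mem_of_injective_columns g hg x)⟩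
  have hf : Function.Injective f := fun x y h => by
    simp only [f, Subtype.mk.injEq, Prod.mk.injEq] at h
    exact hg x y h.1 h.2
  let p : Equiv.Perm lam.cells := Equiv.ofBijective f (Finite.injective_iff_bijective.1 hf)
  have hp : p ∈ lam.rowGroup := mem_rowGroup.2 fun x => rfl
  refine ⟨p⁻¹, inv_mem_rowGroup hp, mem_colGroup.2 fun x => ?_⟩
  have h : (p (p⁻¹ x)).1.2 = (g (p⁻¹ x)).1.2 := rfl
  rw [Equiv.Perm.mul_apply, ← h, ← Equiv.Perm.mul_apply, mul_inv_cancel, Equiv.Perm.one_apply]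

open Classical in
theorem coeff_symmetrizer (w : Equiv.Perm lam.cells) :
    lam.symmetrizer.coeff w = ∑ p ∈ lam.rowGroup,
      if w * p ∈ lam.colGroup then ((Equiv.Perm.sign (w * p) : ℤ) : ℂ) else 0 := by
  rw [symmetrizer, Finset.mul_sum, MonoidAlgebra.coeff_sum, Finsupp.finsetSum_apply]
  refine Finset.sum_nbij' (·⁻¹) (·⁻¹) (fun _ => inv_mem_rowGroup) (fun _ => inv_mem_rowGroup)
    (by simp) (by simp) fun p _ => ?_
  rw [MonoidAlgebra.coeff_mul_single_apply, mul_one, MonoidAlgebra.coeff_sum,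
    Finsupp.finsetSum_apply]
  simp [Finsupp.single_apply]

theorem coeff_symmetrizer_one : lam.symmetrizer.coeff 1 = 1 := by
  classical
  rw [coeff_symmetrizer, Finset.sum_eq_single 1]
  · simp [mem_colGroup]
  · intro p hp hne
    rw [if_neg]
    intro h
    exact hne (eq_one_of_mem_rowGroup_of_mem_colGroup hp (by simpa using h))
  · intro h
    simp [mem_rowGroup] at h

open Classical in
theorem norm_coeff_symmetrizer_le (w : Equiv.Perm lam.cells) :
    ‖lam.symmetrizer.coeff w‖ ≤
      (Fintype.card {p : Equiv.Perm lam.cells // p ∈ lam.rowGroup ∧ w * p ∈ lam.colGroup} : ℝ) := by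
  rw [coeff_symmetrizer]
  refine (norm_sum_le _ _).trans ?_
  rw [Fintype.card_subtype, Finset.filter_and, Finset.filter_univ_mem, Finset.inter_filter,
    Finset.inter_univ, Finset.card_filter, Nat.cast_sum]
  refine Finset.sum_le_sum fun p hp => ?_
  split_ifs
  · rcases Int.units_eq_one_or (Equiv.Perm.sign (w * p)) with h | h <;> rw [h] <;> simp
  · simp

theorem single_mul_symmetrizer {q : Equiv.Perm lam.cells} (hq : q ∈ lam.colGroup) :
    MonoidAlgebra.single q (1 : ℂ) * lam.symmetrizer =
      ((Equiv.Perm.sign q : ℤ) : ℂ) • lam.symmetrizer := by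
  rw [symmetrizer, ← mul_assoc, ← smul_mul_assoc]
  congr 1
  rw [Finset.mul_sum, Finset.smul_sum]
  refine Finset.sum_nbij' (q * ·) (q⁻¹ * ·) (fun s hs => mul_mem_colGroup hq hs)
    (fun s hs => mul_mem_colGroup (inv_mem_colGroup hq) hs) (by simp) (by simp) fun s _ => ?_
  rw [MonoidAlgebra.single_mul_single, one_mul, MonoidAlgebra.smul_single, smul_eq_mul,
    Equiv.Perm.sign_mul, Units.val_mul, Int.cast_mul, ← mul_assoc, ← Int.cast_mul,
    ← Units.val_mul, Int.units_mul_self]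
  simp

theorem symmetrizer_mul_single {p : Equiv.Perm lam.cells} (hp : p ∈ lam.rowGroup) :
    lam.symmetrizer * MonoidAlgebra.single p (1 : ℂ) = lam.symmetrizer := by
  rw [symmetrizer, mul_assoc]
  congr 1
  rw [Finset.sum_mul]
  refine Finset.sum_nbij' (· * p) (· * p⁻¹) (fun s hs => mul_mem_rowGroup hs hp)
    (fun s hs => mul_mem_rowGroup hs (inv_mem_rowGroup hp)) (by simp) (by simp) fun s _ => ?_
  rw [MonoidAlgebra.single_mul_single, one_mul]

/-- The Young symmetrizer spans the space of elements on which the column group acts by the sign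
from the left and the row group acts trivially from the right. -/
theorem eq_smul_symmetrizer (x : lam.BoxAlgebra)
    (hq : ∀ q ∈ lam.colGroup,
      MonoidAlgebra.single q (1 : ℂ) * x = ((Equiv.Perm.sign q : ℤ) : ℂ) • x)
    (hp : ∀ p ∈ lam.rowGroup, x * MonoidAlgebra.single p (1 : ℂ) = x) :
    x = x.coeff 1 • lam.symmetrizer := by
  have hqc : ∀ (y : lam.BoxAlgebra), (∀ q ∈ lam.colGroup,
      MonoidAlgebra.single q (1 : ℂ) * y = ((Equiv.Perm.sign q : ℤ) : ℂ) • y) →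
      ∀ q ∈ lam.colGroup, ∀ g, y.coeff (q * g) = ((Equiv.Perm.sign q : ℤ) : ℂ) * y.coeff g := by
    intro y hy q h g
    have := congrArg (fun z => z.coeff g) (hy q⁻¹ (inv_mem_colGroup h))
    simpa using this
  have hpc : ∀ (y : lam.BoxAlgebra), (∀ p ∈ lam.rowGroup,
      y * MonoidAlgebra.single p (1 : ℂ) = y) →
      ∀ p ∈ lam.rowGroup, ∀ g, y.coeff (g * p) = y.coeff g := by
    intro y hy p h g
    have := congrArg (fun z => z.coeff g) (hy p⁻¹ (inv_mem_rowGroup h))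
    simpa using this
  have key : ∀ (y : lam.BoxAlgebra), (∀ q ∈ lam.colGroup,
      MonoidAlgebra.single q (1 : ℂ) * y = ((Equiv.Perm.sign q : ℤ) : ℂ) • y) →
      (∀ p ∈ lam.rowGroup, y * MonoidAlgebra.single p (1 : ℂ) = y) →
      ∀ g : Equiv.Perm lam.cells, (¬ ∃ p ∈ lam.rowGroup, g * p ∈ lam.colGroup) →
        y.coeff g = 0 := by
    intro y hy1 hy2 g hg
    obtain ⟨a, b, hab, hgab, hne⟩ : ∃ a b : lam.cells,
        a.1.1 = b.1.1 ∧ (g a).1.2 = (g b).1.2 ∧ a ≠ b := by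
      by_contra hcon
      push Not at hcon
      exact hg (exists_rowGroup_mul_mem_colGroup g hcon)
    -- The swap of `a` and `b` is a row permutation, and moved across `g` it becomes an odd column
    -- permutation, so the coefficient at `g` equals its own negative.
    have h1 := hpc y hy2 _ (swap_mem_rowGroup hab) g
    have h2 : g * Equiv.swap a b = Equiv.swap (g a) (g b) * g := by
      rw [Equiv.mul_swap_eq_swap_mul]
    rw [h2, hqc y hy1 _ (swap_mem_colGroup hgab), Equiv.Perm.sign_swap
      (fun h => hne (g.injective h))] at h1
    simp only [Units.val_neg, Units.val_one, Int.cast_neg, Int.cast_one, neg_mul, one_mul] at h1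
    exact self_eq_neg.1 h1.symm
  refine MonoidAlgebra.ext (Finsupp.ext fun g => ?_)
  rw [MonoidAlgebra.coeff_smul, Finsupp.smul_apply, smul_eq_mul]
  by_cases hg : ∃ p ∈ lam.rowGroup, g * p ∈ lam.colGroup
  · obtain ⟨p, hpm, hqm⟩ := hg
    have h : ∀ (y : lam.BoxAlgebra), (∀ q ∈ lam.colGroup,
      MonoidAlgebra.single q (1 : ℂ) * y = ((Equiv.Perm.sign q : ℤ) : ℂ) • y) →
      (∀ p ∈ lam.rowGroup, y * MonoidAlgebra.single p (1 : ℂ) = y) →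
      y.coeff g = ((Equiv.Perm.sign (g * p) : ℤ) : ℂ) * y.coeff 1 := fun y h1 h2 => by
      rw [← hpc y h2 p hpm g, ← hqc y h1 _ hqm, mul_one]
    rw [h x hq hp, h lam.symmetrizer (fun q hq => single_mul_symmetrizer hq)
      (fun p hp => symmetrizer_mul_single hp), coeff_symmetrizer_one]
    ring
  · rw [key x hq hp g hg, key lam.symmetrizer (fun q hq => single_mul_symmetrizer hq)
      (fun p hp => symmetrizer_mul_single hp) g hg, mul_zero]

theorem symmetrizer_mul_self :
    lam.symmetrizer * lam.symmetrizer =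
      (lam.symmetrizer * lam.symmetrizer).coeff 1 • lam.symmetrizer :=
  eq_smul_symmetrizer _
    (fun q hq => by rw [← mul_assoc, single_mul_symmetrizer hq, smul_mul_assoc])
    (fun p hp => by rw [mul_assoc, symmetrizer_mul_single hp])

/-! ### The character in terms of coefficients of the symmetrizer -/

theorem trace_mulLeft_comp_mulRight (g : Equiv.Perm lam.cells) (c : lam.BoxAlgebra) :
    LinearMap.trace ℂ lam.BoxAlgebra
      (LinearMap.mulLeft ℂ (MonoidAlgebra.single g (1 : ℂ)) ∘ₗ LinearMap.mulRight ℂ c) =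
      ∑ h : Equiv.Perm lam.cells, c.coeff (h⁻¹ * g⁻¹ * h) := by
  classical
  rw [LinearMap.trace_eq_matrix_trace ℂ (MonoidAlgebra.basis (Equiv.Perm lam.cells) ℂ),
    Matrix.trace]
  refine Finset.sum_congr rfl fun h _ => ?_
  rw [Matrix.diag_apply, LinearMap.toMatrix_apply, MonoidAlgebra.basis_apply]
  change (MonoidAlgebra.single g (1 : ℂ) * (MonoidAlgebra.single h 1 * c)).coeff h = _
  simp [mul_assoc]

/-- Right multiplication by the symmetrizer maps the algebra onto the ideal and acts on the ideal as
a scalar; cyclicity of the trace moves the computation to the whole algebra. -/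
theorem smul_trace_boxIrrep (g : Equiv.Perm lam.cells) :
    (lam.symmetrizer * lam.symmetrizer).coeff 1 *
        LinearMap.trace ℂ lam.irrepSpace (lam.boxIrrep g) =
      ∑ h : Equiv.Perm lam.cells, lam.symmetrizer.coeff (h⁻¹ * g⁻¹ * h) := by
  set α := (lam.symmetrizer * lam.symmetrizer).coeff 1 with hα
  rw [← trace_mulLeft_comp_mulRight, ← smul_eq_mul, ← map_smul]
  have h : LinearMap.mulLeft ℂ (MonoidAlgebra.single g (1 : ℂ)) ∘ₗ
      LinearMap.mulRight ℂ lam.symmetrizer =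
      (LinearMap.mulLeft ℂ (MonoidAlgebra.single g (1 : ℂ)) ∘ₗ lam.irrepSpace.subtype) ∘ₗ
        (LinearMap.mulRight ℂ lam.symmetrizer).rangeRestrict := rfl
  rw [h]
  refine Eq.trans ?_ (LinearMap.trace_comp_comm' (R := ℂ)
    (LinearMap.mulRight ℂ lam.symmetrizer).rangeRestrict
    (LinearMap.mulLeft ℂ (MonoidAlgebra.single g (1 : ℂ)) ∘ₗ lam.irrepSpace.subtype)).symm
  congr 1
  ext ⟨_, w, rfl⟩ : 1
  refine Subtype.ext ?_
  change α • (MonoidAlgebra.single g (1 : ℂ) * (w * lam.symmetrizer)) =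
    (MonoidAlgebra.single g (1 : ℂ) * (w * lam.symmetrizer)) * lam.symmetrizer
  rw [mul_assoc, mul_assoc, symmetrizer_mul_self, ← hα, mul_smul_comm, mul_smul_comm]

/-- The scalar cancels in the quotient. Taking `g = 1` gives scalar times dimension equal to `n!`,
so it is nonzero and need not be computed. -/
theorem trace_boxIrrep_div (g : Equiv.Perm lam.cells) :
    LinearMap.trace ℂ lam.irrepSpace (lam.boxIrrep g) /
        LinearMap.trace ℂ lam.irrepSpace (lam.boxIrrep 1) =
      (∑ h : Equiv.Perm lam.cells, lam.symmetrizer.coeff (h⁻¹ * g⁻¹ * h)) /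
        (lam.card.factorial : ℂ) := by
  have h1 : (lam.symmetrizer * lam.symmetrizer).coeff 1 *
      LinearMap.trace ℂ lam.irrepSpace (lam.boxIrrep 1) = (lam.card.factorial : ℂ) := by
    rw [smul_trace_boxIrrep]
    simp [coeff_symmetrizer_one, Fintype.card_perm, YoungDiagram.card]
  have h0 : (lam.symmetrizer * lam.symmetrizer).coeff 1 ≠ 0 := by
    intro h
    rw [h, zero_mul] at h1
    exact Nat.factorial_ne_zero _ (by exact_mod_cast h1.symm)
  rw [← smul_trace_boxIrrep, ← h1, mul_div_mul_left _ _ h0]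

end YoungDiagram

/-! ### Comparison of the two counts -/

/-- An extension is determined by its restriction to the complement of the range of `ι`, which
embeds into the complement of the range of `F`. -/
theorem card_equiv_extending_le {α β γ : Type*} [Fintype α] [Fintype β] [Fintype γ]
    [DecidableEq α] [DecidableEq β] [DecidableEq γ] (ι : γ ↪ α) (F : γ → β)
    (h : Fintype.card α = Fintype.card β) :
    (Finset.univ.filter fun f : α ≃ β => f ∘ ι = F).card ≤
      (Fintype.card α - Fintype.card γ).factorial := by
  by_cases hF : Function.Injective F
  swap
  · rw [Finset.filter_false_of_mem fun (f : α ≃ β) _ (hf : f ∘ ι = F) =>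
      hF (hf ▸ f.injective.comp ι.injective)]
    simp
  have hα : Fintype.card {x // x ∉ Set.range ι} = Fintype.card α - Fintype.card γ := by
    rw [Fintype.card_subtype_compl]
    congr 1
    exact Set.card_range_of_injective ι.injective
  have hβ : Fintype.card {x // x ∉ Set.range F} = Fintype.card α - Fintype.card γ := by
    rw [Fintype.card_subtype_compl, h]
    congr 1
    exact Set.card_range_of_injective hF
  have h1 := Fintype.card_embedding_eq (α := {x // x ∉ Set.range ι}) (β := {x // x ∉ Set.range F})
  rw [hα, hβ, Nat.descFactorial_self] at h1
  rw [← h1, ← Fintype.card_subtype]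
  refine Fintype.card_le_of_injective (fun f => ⟨fun x => ⟨f.1 x.1, ?_⟩, ?_⟩) ?_
  · rintro ⟨m, hm⟩
    rw [← congrFun f.2 m, Function.comp_apply] at hm
    exact x.2 ⟨m, f.1.injective hm⟩
  · intro x y hxy
    exact Subtype.ext (f.1.injective (congrArg Subtype.val hxy))
  · intro f f' hff
    refine Subtype.ext (Equiv.ext fun x => ?_)
    by_cases hx : x ∈ Set.range ι
    · obtain ⟨m, rfl⟩ := hx
      exact congrFun (f.2.trans f'.2.symm) m
    · exact congrArg Subtype.val (DFunLike.congr_fun hff ⟨x, hx⟩)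

namespace YoungDiagram

variable {lam : YoungDiagram}

open Classical in
/-- The number of permutations `σ` such that the row of `F` is invariant under `σ` and the column
of `F` is invariant under `π * σ`. -/
def countInvariant {l : ℕ} (π : Equiv.Perm (Fin l)) (F : Fin l → lam.cells) : ℕ :=
  Fintype.card {σ : Equiv.Perm (Fin l) // (∀ m, (F (σ m)).1.1 = (F m).1.1) ∧
    ∀ m, (F (π (σ m))).1.2 = (F m).1.2}

theorem sum_countInvariant_le {l N : ℕ} (π : Equiv.Perm (Fin l)) (hcol : lam.rowLen 0 ≤ N)
    (hrow : lam.colLen 0 ≤ N) :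
    ∑ F : Fin l → lam.cells, lam.countInvariant π F ≤ lam.countLabellings N π := by
  classical
  unfold countInvariant countLabellings
  rw [← Fintype.card_sigma]
  have hr : ∀ x : lam.cells, x.1.1 < N := fun x =>
    (mem_iff_lt_colLen.1 ((lam.mem_cells _).1 x.2 : (x.1.1, x.1.2) ∈ lam)).trans_le
      ((lam.colLen_anti _ _ (Nat.zero_le _)).trans hrow)
  have hc : ∀ x : lam.cells, x.1.2 < N := fun x =>
    (mem_iff_lt_rowLen.1 ((lam.mem_cells _).1 x.2 : (x.1.1, x.1.2) ∈ lam)).trans_le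
      ((lam.rowLen_anti _ _ (Nat.zero_le _)).trans hcol)
  refine Fintype.card_le_of_injective (fun t => ⟨(fun m => ⟨(t.1 m).1.2, hc _⟩,
    fun m => ⟨(t.1 m).1.1, hr _⟩, t.2.1), fun m => (lam.mem_cells _).1 (t.1 m).2,
    funext fun m => Fin.ext (t.2.2.2 m), funext fun m => Fin.ext (t.2.2.1 m)⟩) ?_
  rintro ⟨F, σ, hσ⟩ ⟨F', σ', hσ'⟩ h
  simp only [Subtype.mk.injEq, Prod.mk.injEq, funext_iff, Fin.mk.injEq] at h
  obtain ⟨h1, h2, rfl⟩ := h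
  obtain rfl : F = F' := funext fun m => Subtype.ext (Prod.ext (h2 m) (h1 m))
  rfl

-- Off the range of `F` the permutation `w` is trivial, so `p⁻¹ x` shares both row and column with
-- `x` and `p` fixes `x`. Thus `p` permutes the range of `F` and is determined by the induced `σ`.
open Classical in
theorem card_rowGroup_mul_mem_colGroup_le {l n : ℕ} (hl : l ≤ n) (π : Equiv.Perm (Fin l))
    (f : Fin n ≃ lam.cells) :
    Fintype.card {p : Equiv.Perm lam.cells // p ∈ lam.rowGroup ∧
      f.permCongr (π.viaEmbedding (Fin.castLEEmb hl)) * p ∈ lam.colGroup} ≤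
      lam.countInvariant π (f ∘ Fin.castLEEmb hl) := by
  set F : Fin l → lam.cells := f ∘ Fin.castLEEmb hl with hF
  set w := f.permCongr (π.viaEmbedding (Fin.castLEEmb hl)) with hw
  have hFinj : Function.Injective F := f.injective.comp (Fin.castLEEmb hl).injective
  have hwF : ∀ m, w (F m) = F (π m) := fun m => by
    rw [hw, hF, Equiv.permCongr_apply, Function.comp_apply, Equiv.symm_apply_apply,
      Equiv.Perm.viaEmbedding_apply, Function.comp_apply]
  have hwF' : ∀ x ∉ Set.range F, w x = x := fun x hx => by
    rw [hw, Equiv.permCongr_apply, Equiv.Perm.viaEmbedding_apply_of_notMem, Equiv.apply_symm_apply]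
    rintro ⟨m, hm⟩
    exact hx ⟨m, by rw [hF, Function.comp_apply, hm, Equiv.apply_symm_apply]⟩
  have hfix : ∀ p : Equiv.Perm lam.cells, p ∈ lam.rowGroup → w * p ∈ lam.colGroup →
      ∀ x ∉ Set.range F, p x = x := by
    intro p hp hwp x hx
    have hx' : w⁻¹ x = x := by rw [Equiv.Perm.inv_eq_iff_eq, hwF' x hx]
    -- `p⁻¹ x` lies in the row of `x` and, as `w` fixes `x`, in its column
    have h1 := mem_rowGroup.1 (inv_mem_rowGroup hp) x
    have h2 := mem_colGroup.1 (inv_mem_colGroup hwp) x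
    rw [mul_inv_rev, Equiv.Perm.mul_apply, hx'] at h2
    rw [eq_comm, ← Equiv.Perm.inv_eq_iff_eq]
    exact Subtype.ext (Prod.ext h1 h2)
  have hex : ∀ p : {p : Equiv.Perm lam.cells // p ∈ lam.rowGroup ∧ w * p ∈ lam.colGroup},
      ∃ σ : Equiv.Perm (Fin l), ∀ m, F (σ m) = p.1 (F m) := by
    rintro ⟨p, hp, hwp⟩
    have hmem : ∀ m, ∃ m', F m' = p (F m) := fun m => by
      by_contra h
      have h' := hfix p hp hwp _ h
      exact h ⟨m, (p.injective h').symm⟩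
    choose s hs using hmem
    have hsinj : Function.Injective s := fun m m' h =>
      hFinj (p.injective (by rw [← hs, ← hs, h]))
    exact ⟨Equiv.ofBijective s (Finite.injective_iff_bijective.1 hsinj), hs⟩
  choose s hs using hex
  refine Fintype.card_le_of_injective (fun p => ⟨s p, fun m => ?_, fun m => ?_⟩) ?_
  · rw [hs, mem_rowGroup.1 p.2.1]
  · rw [← hwF, hs, ← Equiv.Perm.mul_apply, mem_colGroup.1 p.2.2]
  · intro p p' hpp
    simp only [Subtype.mk.injEq] at hpp
    refine Subtype.ext (Equiv.ext fun x => ?_)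
    by_cases hx : x ∈ Set.range F
    · obtain ⟨m, rfl⟩ := hx
      rw [← hs, ← hs, hpp]
    · rw [hfix _ p.2.1 p.2.2 x hx, hfix _ p'.2.1 p'.2.2 x hx]

/-- Composing the chosen numbering with all permutations of the boxes yields every numbering once,
so the choice disappears. -/
theorem chi_eq (π : Equiv.Perm (Fin lam.card)) :
    lam.chi π = (∑ f : Fin lam.card ≃ lam.cells, lam.symmetrizer.coeff (f.permCongr π⁻¹)) /
      (lam.card.factorial : ℂ) := by
  have h : ∀ g, lam.irrep g = lam.boxIrrep (lam.cells.equivFin.symm.permCongr g) := fun g => rfl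
  rw [chi, h, h, show lam.cells.equivFin.symm.permCongr 1 = 1 from
    map_one lam.cells.equivFin.symm.permCongrHom, trace_boxIrrep_div]
  congr 1
  refine Fintype.sum_equiv ((Equiv.inv _).trans
    (Equiv.equivCongr lam.cells.equivFin (Equiv.refl lam.cells))) _ _ fun _ => rfl

theorem norm_normalizedChar_le {l N : ℕ} (hl : l ≤ lam.card) (π : Equiv.Perm (Fin l))
    (hcol : lam.rowLen 0 ≤ N) (hrow : lam.colLen 0 ≤ N) :
    ‖lam.normalizedChar hl π‖ ≤ lam.countLabellings N π⁻¹ := by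
  classical
  have hinv : (π.viaEmbedding (Fin.castLEEmb hl))⁻¹ = π⁻¹.viaEmbedding (Fin.castLEEmb hl) :=
    (map_inv (Equiv.Perm.viaEmbeddingHom (Fin.castLEEmb hl)) π).symm
  have hcard : Fintype.card (Fin lam.card) = Fintype.card lam.cells := by simp [YoungDiagram.card]
  have hsum : ∑ f : Fin lam.card ≃ lam.cells, lam.countInvariant π⁻¹ (f ∘ Fin.castLEEmb hl) ≤
      (lam.card - l).factorial * lam.countLabellings N π⁻¹ := by
    refine le_trans ?_ (Nat.mul_le_mul_left _ (sum_countInvariant_le π⁻¹ hcol hrow))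
    rw [← Finset.sum_fiberwise Finset.univ
      fun f : Fin lam.card ≃ lam.cells => (f ∘ Fin.castLEEmb hl : Fin l → lam.cells),
      Finset.mul_sum]
    refine Finset.sum_le_sum fun F _ => ?_
    rw [Finset.sum_congr rfl (g := fun _ => lam.countInvariant π⁻¹ F)
      fun f hf => by rw [(Finset.mem_filter.1 hf).2], Finset.sum_const, smul_eq_mul]
    refine Nat.mul_le_mul_right _ ?_
    simpa using card_equiv_extending_le (Fin.castLEEmb hl) F hcard
  have hnorm : ‖∑ f : Fin lam.card ≃ lam.cells, lam.symmetrizer.coeff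
      (f.permCongr (π.viaEmbedding (Fin.castLEEmb hl))⁻¹)‖ ≤
      (lam.card - l).factorial * lam.countLabellings N π⁻¹ := by
    refine (norm_sum_le _ _).trans (le_trans ?_ (Nat.cast_le.2 hsum |>.trans_eq (Nat.cast_mul _ _)))
    rw [Nat.cast_sum]
    refine Finset.sum_le_sum fun f _ => (norm_coeff_symmetrizer_le _).trans ?_
    rw [hinv]
    exact_mod_cast card_rowGroup_mul_mem_colGroup_le hl π⁻¹ f
  rw [normalizedChar, chi_eq, norm_mul, norm_div, Complex.norm_natCast, Complex.norm_natCast,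
    ← Nat.factorial_mul_descFactorial hl]
  have h1 : (0 : ℝ) < (lam.card - l).factorial := by exact_mod_cast Nat.factorial_pos _
  have h2 : (0 : ℝ) < lam.card.descFactorial l := by
    exact_mod_cast Nat.descFactorial_pos.2 hl
  push_cast
  rw [mul_div_assoc', mul_comm, mul_div_mul_right _ _ h2.ne', div_le_iff₀' h1]
  exact hnorm

end YoungDiagram

/-- The trace reads off coefficients at inverses, so the character bound involves `π⁻¹`; this
returns to `π`. -/
theorem cycleTraceProd_inv {l N : ℕ} (π : Equiv.Perm (Fin l)) (A : Matrix (Fin N) (Fin N) ℂ) :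
    cycleTraceProd π⁻¹ A = cycleTraceProd π A := by
  have h : π⁻¹.partition = π.partition := Equiv.Perm.partition_eq_of_isConj.1
    (Equiv.Perm.isConj_iff_cycleType_eq.2 π.cycleType_inv)
  rw [cycleTraceProd, cycleTraceProd, h]

end

theorem mainTheorem11 (lam : YoungDiagram) {l : ℕ} (hl : l ≤ lam.card) (π : Equiv.Perm (Fin l))
    {Ω : Type*} [MeasurableSpace Ω] (P : Measure Ω) [IsProbabilityMeasure P]
    {N : ℕ} (hcol : lam.rowLen 0 ≤ N) (hrow : lam.colLen 0 ≤ N)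
    (T : Ω → Matrix (Fin N) (Fin N) ℂ) (hT : lam.IsGaussianMatrix P T) :
    Integrable (fun ω => cycleTraceProd π (T ω)) P ∧
      (∫ ω, cycleTraceProd π (T ω) ∂P).im = 0 ∧
      ‖lam.normalizedChar hl π‖ ≤ (∫ ω, cycleTraceProd π (T ω) ∂P).re := by
  have h : ∫ ω, cycleTraceProd π (T ω) ∂P = (lam.countLabellings N π⁻¹ : ℂ) := by
    simp_rw [← cycleTraceProd_inv π]
    exact hT.integral_cycleTraceProd π⁻¹
  rw [h, Complex.natCast_im, Complex.natCast_re]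
  exact ⟨hT.integrable_cycleTraceProd π, rfl, lam.norm_normalizedChar_le hl π hcol hrow⟩
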